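/- Let $\Omega\subset\mathbb R^d$ be compact, $\mu$ a Borel probability measure on $\Omega$, and $C(\Omega)$ the space of continuous real- or complex-valued functions on $\Omega$. A $\mathbf\Phi$-function is a non-decreasing function $\Phi\colon[0,\infty)\to[0,\infty)$ with $\Phi(0)=0$, $\lim_{t\to0+}\Phi(t)=0$, $\lim_{t\to\infty}\Phi(t)=\infty$ that satisfies $(\mathrm{aInc})_1$; here $\Phi\in(\mathrm{aInc})_p$ with constant $a_\Phi(p)\ge1$ means that $\Phi(s)s^{-p}\le a_\Phi(p)\,\Phi(t)t^{-p}$ for all $0<s<t$. Put $$\|f\|_\Phi=\inf\Bigl\{\lambda>0:\int_\Omega\Phi(|f|/\lambda)\,d\mu\le1\Bigr\},\qquad \|f\|_{2,\mathbf x}=\Bigl(\frac1m\sum_{j=1}^m|f(x_j)|^2\Bigr)^{1/2}\quad\text{for }\mathbf x=(x_1,\dots,x_m)\in\Omega^m.$$ **Theorem.** There are numerical constants $c_1>0$ and $C\ge1$ such that the following holds. Let $p\in[2,\infty)$, and let $\Phi$ be a $\mathbf\Phi$-function with $\Phi(1)>0$ and $\Phi\in(\mathrm{aInc})_p$ with constant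 $a_\Phi(p)$. Put $$c_2(\Phi,p)=C\,a_\Phi(p)^{2/p}\bigl(1+\Phi(1)^{-1}\bigr)^{1/p}.$$ Then for all $d$, $\Omega\subset\mathbb R^d$, $\mu$ as above, every integer $N\ge1$ and every $N$-dimensional subspace $X_N\subset C(\Omega)$, there are an integer $1\le m\le c_1N$ and points $x_1,\dots,x_m\in\Omega$ (not necessarily distinct) such that $$\|f\|_\Phi\le c_2(\Phi,p)\Bigl(\frac{\Phi(\sqrt N)}{N}\Bigr)^{1/p}\|f\|_{2,\mathbf x}\qquad\text{for all } f\in X_N.$$ -/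

import Mathlib

open Filter Topology MeasureTheory
open scoped NNReal ENNReal

noncomputable section

/-- `φ` is almost increasing on `(0, ∞)` with the constant `a ≥ 1`. -/
def AlmostIncreasingWith (a : ℝ≥0) (φ : ℝ≥0 → ℝ≥0) : Prop :=
  1 ≤ a ∧ ∀ s t : ℝ≥0, 0 < s → s < t → φ s ≤ a * φ t

/-- The condition `(aInc)_p` with the constant `a`: the function `t ↦ Φ(t) t^(-p)` is almost
increasing on `(0, ∞)` with the constant `a`. -/
def AIncWith (p : ℝ) (a : ℝ≥0) (Φ : ℝ≥0 → ℝ≥0) : Prop :=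
  AlmostIncreasingWith a (fun t => Φ t * t ^ (-p))

/-- A `Φ`-function on `[0, ∞)`: a (weakly) increasing function with `Φ(0) = 0`, `Φ(t) → 0` as
`t → 0+`, `Φ(t) → ∞` as `t → ∞`, that satisfies `(aInc)_1` with some constant. -/
structure IsPhiFunction (Φ : ℝ≥0 → ℝ≥0) : Prop where
  monotone : Monotone Φ
  map_zero : Φ 0 = 0
  tendsto_zero : Tendsto Φ (𝓝[>] 0) (𝓝 0)
  tendsto_atTop : Tendsto Φ atTop atTop
  aInc_one : ∃ a : ℝ≥0, AIncWith 1 a Φ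

/-- The modular `ρ_Φ(f) = ∫ Φ(|f|) dμ`, with values in `[0, ∞]`. -/
def orliczModular {α E : Type*} [MeasurableSpace α] [NormedAddCommGroup E]
    (Φ : ℝ≥0 → ℝ≥0) (μ : Measure α) (f : α → E) : ℝ≥0∞ :=
  ∫⁻ x, (Φ ‖f x‖₊ : ℝ≥0∞) ∂μ

/-- The Luxemburg functional `inf {r > 0 : ρ_Φ(f / r) ≤ 1}`, with values in `[0, ∞]`
(it is `∞` when there is no such `r`). -/
def luxemburgNorm {α E : Type*} [MeasurableSpace α] [NormedAddCommGroup E] [NormedSpace ℝ E]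
    (Φ : ℝ≥0 → ℝ≥0) (μ : Measure α) (f : α → E) : ℝ≥0∞ :=
  ⨅ (r : ℝ≥0) (_ : 0 < r) (_ : orliczModular Φ μ (fun x => (r : ℝ)⁻¹ • f x) ≤ 1), (r : ℝ≥0∞)

/-- The discrete `L²`-norm `(1/m ∑_j |f(x_j)|²)^(1/2)` for the points `x_1, …, x_m`
(equal weights, a repeated point is counted with its multiplicity). -/
def discreteL2Norm {α E : Type*} [NormedAddCommGroup E] {m : ℕ} (x : Fin m → α) (f : α → E) : ℝ :=
  Real.sqrt ((1 / (m : ℝ)) * ∑ j, ‖f (x j)‖ ^ 2)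

end

/-! It suffices to find `4 * N` points whose discrete norm `D` controls two norms at once: `|f| ≤ K
√N` everywhere and `‖f‖_{L²(μ)} ≤ K`, with `K = 3 D`. Then `s = |f| / K ≤ √N`, and since `p ≥ 2`,
`(aInc)_p` compared at `√N` gives `Φ(s / Λ) ≤ s²` for the dilation `Λ = luxemburgConst p a Φ N`;
integrating bounds the modular by `1`.

For the points, write `f(y) = u(y)* c` in a basis. Maximizing the determinant over the closed convex
hull of the matrices `u u*` gives `M` with `|f|² ≤ N c* M c` (`exists_kiefer_wolfowitz`). The Gram
matrix `A` of `μ` also lies in the hull, hence so does `G = (M + A) / 2`, which controls both norms.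
After a change of basis making `G` the identity, a one-sided barrier argument of
Batson–Spielman–Srivastava type (`PosDef.exists_barrier_step`) selects points one at a time with
equal weights, until `∑ u(x_j) u(x_j)*` dominates `N G`. Only the lower frame bound is needed, which
is why no weights appear. -/

namespace Matrix

open scoped ComplexOrder MatrixOrder

/-! ### Positive definite matrices and the lower barrier -/

section

variable {𝕜 n : Type*} [RCLike 𝕜] [Fintype n] [DecidableEq n]

/-- Cauchy–Schwarz for the form of `H` and its dual: with `q = u* H⁻¹ u` and `w = u* c`, evaluate
the form of `H` at `q c - w H⁻¹ u` and divide by `q`. -/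
theorem PosDef.norm_sq_star_dotProduct_le {H : Matrix n n 𝕜} (hH : H.PosDef) (u c : n → 𝕜) :
    ‖star u ⬝ᵥ c‖ ^ 2 ≤ RCLike.re (star u ⬝ᵥ (H⁻¹ *ᵥ u)) * RCLike.re (star c ⬝ᵥ (H *ᵥ c)) := by
  by_cases hu : u = 0
  · simp [hu]
  have hdet : IsUnit H.det := (Matrix.isUnit_iff_isUnit_det H).1 hH.isUnit
  set q : ℝ := RCLike.re (star u ⬝ᵥ (H⁻¹ *ᵥ u)) with hq
  have hqpos : 0 < q := hH.inv.re_dotProduct_pos hu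
  have hqc : star u ⬝ᵥ (H⁻¹ *ᵥ u) = (q : 𝕜) := by
    have h := hH.inv.dotProduct_mulVec_pos hu
    rw [RCLike.pos_iff] at h
    apply RCLike.ext
    · simp [hq]
    · simp [h.2]
  set w : 𝕜 := star u ⬝ᵥ c with hw
  have hw' : star c ⬝ᵥ u = star w := by
    rw [hw, star_dotProduct]
  have h0 := hH.posSemidef.re_dotProduct_nonneg ((q : 𝕜) • c - w • (H⁻¹ *ᵥ u))
  have e1 : H *ᵥ (H⁻¹ *ᵥ u) = u := by
    rw [mulVec_mulVec, mul_nonsing_inv _ hdet, one_mulVec]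
  have e2 : star (H⁻¹ *ᵥ u) ⬝ᵥ (H *ᵥ c) = w := by
    rw [star_mulVec, hH.inv.isHermitian.eq, ← dotProduct_mulVec, mulVec_mulVec,
      nonsing_inv_mul _ hdet, one_mulVec]
  have e3 : star (H⁻¹ *ᵥ u) ⬝ᵥ u = (q : 𝕜) := by
    rw [star_mulVec, hH.inv.isHermitian.eq, ← dotProduct_mulVec, hqc]
  have key : star ((q : 𝕜) • c - w • (H⁻¹ *ᵥ u)) ⬝ᵥ (H *ᵥ ((q : 𝕜) • c - w • (H⁻¹ *ᵥ u)))
      = (q : 𝕜) * (q * (star c ⬝ᵥ (H *ᵥ c)) - (‖w‖ ^ 2 : ℝ)) := by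
    have hn : ((‖w‖ ^ 2 : ℝ) : 𝕜) = star w * w := by
      rw [RCLike.star_def, RCLike.conj_mul]; push_cast; rfl
    rw [mulVec_sub, mulVec_smul, mulVec_smul, e1, hn]
    simp only [star_sub, star_smul, sub_dotProduct, dotProduct_sub, smul_dotProduct,
      dotProduct_smul, smul_eq_mul, e2, e3, hw', RCLike.star_def, RCLike.conj_ofReal]
    ring
  rw [key, RCLike.re_ofReal_mul, map_sub, RCLike.re_ofReal_mul, RCLike.ofReal_re] at h0
  nlinarith [nonneg_of_mul_nonneg_right h0 hqpos]

theorem PosSemidef.le_one_of_trace_le {Z : Matrix n n 𝕜} (hZ : Z.PosSemidef)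
    (h : RCLike.re Z.trace ≤ 1) : (1 - Z).PosSemidef := by
  rw [← Matrix.le_iff, ← map_one (algebraMap ℝ (Matrix n n 𝕜)),
    le_algebraMap_iff_spectrum_le (ha := hZ.isHermitian)]
  intro x hx
  rw [hZ.isHermitian.spectrum_real_eq_range_eigenvalues] at hx
  obtain ⟨i, rfl⟩ := hx
  rw [hZ.isHermitian.trace_eq_sum_eigenvalues, ← RCLike.ofReal_sum, RCLike.ofReal_re] at h
  exact (Finset.single_le_sum (fun j _ => hZ.eigenvalues_nonneg j) (Finset.mem_univ i)).trans h

/-- The trace bound gives `H⁻¹ ≤ 1`, and Cauchy–Schwarz with both vectors equal to `x` turns this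
into `1 ≤ H`. It keeps `H - 1/2` positive definite when the barrier moves. -/
theorem PosDef.one_le_of_trace_inv_le {H : Matrix n n 𝕜} (hH : H.PosDef)
    (h : RCLike.re (H⁻¹).trace ≤ 1) : (H - 1).PosSemidef := by
  have hZ := hH.inv.posSemidef.le_one_of_trace_le h
  refine .of_dotProduct_mulVec_nonneg (hH.isHermitian.sub isHermitian_one) fun x => ?_
  by_cases hx : x = 0
  · simp [hx]
  have hherm : (H - 1).IsHermitian := hH.isHermitian.sub isHermitian_one
  have hre : 0 ≤ RCLike.re (star x ⬝ᵥ ((H - 1) *ᵥ x)) := by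
    have h1 := hZ.re_dotProduct_nonneg x
    have h2 := hH.norm_sq_star_dotProduct_le x x
    have h3 := hH.re_dotProduct_pos hx
    simp only [sub_mulVec, one_mulVec, dotProduct_sub, map_sub] at h1 ⊢
    have h4 : RCLike.re (star x ⬝ᵥ x) ≤ ‖star x ⬝ᵥ x‖ := RCLike.re_le_norm _
    have h5 : 0 < RCLike.re (star x ⬝ᵥ x) := by
      have := (PosDef.one (n := n) (R := 𝕜)).re_dotProduct_pos hx
      simpa using this
    have h6 : RCLike.re (star x ⬝ᵥ x) ^ 2 ≤ ‖star x ⬝ᵥ x‖ ^ 2 := by gcongr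
    have h7 : RCLike.re (star x ⬝ᵥ x) * RCLike.re (star x ⬝ᵥ x)
        ≤ RCLike.re (star x ⬝ᵥ x) * RCLike.re (star x ⬝ᵥ (H *ᵥ x)) := by
      nlinarith
    linarith [le_of_mul_le_mul_left h7 h5]
  rw [RCLike.nonneg_iff]
  exact ⟨hre, hherm.im_star_dotProduct_mulVec_self x⟩

theorem PosDef.exists_mul_mul_conjTranspose_eq_one {G : Matrix n n 𝕜} (hG : G.PosDef) :
    ∃ P : Matrix n n 𝕜, IsUnit P ∧ P * G * Pᴴ = 1 := by
  obtain ⟨C, hC⟩ := CStarAlgebra.nonneg_iff_eq_star_mul_self.mp hG.posSemidef.nonneg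
  rw [star_eq_conjTranspose] at hC
  have hCdet : IsUnit C.det := by
    have h := (Matrix.isUnit_iff_isUnit_det G).1 hG.isUnit
    rw [hC, det_mul] at h
    exact isUnit_of_mul_isUnit_right h
  have hC'det : IsUnit (Cᴴ).det := by rw [det_conjTranspose]; exact hCdet.star
  refine ⟨(Cᴴ)⁻¹, ?_, ?_⟩
  · rw [Matrix.isUnit_nonsing_inv_iff, Matrix.isUnit_iff_isUnit_det]; exact hC'det
  · rw [hC, nonsing_inv_mul_cancel_left _ _ hC'det, conjTranspose_nonsing_inv,
      conjTranspose_conjTranspose, mul_nonsing_inv _ hCdet]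

theorem PosDef.trace_inv_add_vecMulVec {R : Matrix n n 𝕜} (hR : R.PosDef) (u : n → 𝕜) :
    RCLike.re (R + vecMulVec u (star u))⁻¹.trace = RCLike.re (R⁻¹).trace -
      RCLike.re (star u ⬝ᵥ ((R⁻¹ * R⁻¹) *ᵥ u)) / (1 + RCLike.re (star u ⬝ᵥ (R⁻¹ *ᵥ u))) := by
  have hdet : IsUnit R.det := (Matrix.isUnit_iff_isUnit_det R).1 hR.isUnit
  set q : ℝ := RCLike.re (star u ⬝ᵥ (R⁻¹ *ᵥ u)) with hq
  have hqpos : 0 ≤ q := hR.inv.posSemidef.re_dotProduct_nonneg u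
  have hqc : star u ⬝ᵥ (R⁻¹ *ᵥ u) = (q : 𝕜) := by
    apply RCLike.ext
    · simp [hq]
    · simp [hR.inv.isHermitian.im_star_dotProduct_mulVec_self u]
  have hne : (1 + q : 𝕜) ≠ 0 := by
    have : ((1 + q : ℝ) : 𝕜) ≠ 0 := RCLike.ofReal_ne_zero.2 (by positivity)
    simpa using this
  -- The Sherman–Morrison formula.
  have hinv : (R + vecMulVec u (star u))⁻¹ =
      R⁻¹ - (1 + q : 𝕜)⁻¹ • vecMulVec (R⁻¹ *ᵥ u) (star u ᵥ* R⁻¹) := by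
    apply inv_eq_right_inv
    rw [add_mul, mul_sub, mul_sub, mul_nonsing_inv _ hdet, Matrix.mul_smul, Matrix.mul_smul,
      mul_vecMulVec, mulVec_mulVec, mul_nonsing_inv _ hdet, one_mulVec, vecMulVec_mul_vecMulVec,
      vecMulVec_mul, hqc]
    have h : (1 + q : 𝕜)⁻¹ • vecMulVec u (star u ᵥ* R⁻¹)
        + (1 + q : 𝕜)⁻¹ • ((q : 𝕜) • vecMulVec u (star u ᵥ* R⁻¹)) =
          vecMulVec u (star u ᵥ* R⁻¹) := by
      rw [smul_smul, ← add_smul, ← mul_one_add, inv_mul_cancel₀ hne, one_smul]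
    rw [vecMulVec_smul]
    nth_rewrite 2 [← h]
    abel
  rw [hinv, trace_sub, trace_smul, trace_vecMulVec, map_sub, dotProduct_comm, ← dotProduct_mulVec,
    mulVec_mulVec]
  congr 1
  rw [smul_eq_mul, div_eq_inv_mul]
  have : (1 + q : 𝕜)⁻¹ = (((1 + q)⁻¹ : ℝ) : 𝕜) := by push_cast; rfl
  rw [this, RCLike.re_ofReal_mul]

theorem PosSemidef.re_trace_mul_nonneg {A B : Matrix n n 𝕜} (hA : A.PosSemidef)
    (hB : B.PosSemidef) : 0 ≤ RCLike.re (A * B).trace := by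
  obtain ⟨C, rfl⟩ := CStarAlgebra.nonneg_iff_eq_star_mul_self.mp hA.nonneg
  rw [star_eq_conjTranspose, mul_assoc, trace_mul_comm]
  exact (RCLike.nonneg_iff.1 (hB.mul_mul_conjTranspose_same C).trace_nonneg).1

/-- Lowering `H` by `1/2` raises the trace of the inverse by some `T`; the rank one update must win
back at least `T`. By Sherman–Morrison this asks for `w* (Y² - T Y) w ≥ T` with `Y = (H - 1/2)⁻¹`.
The hypothesis on `w` reduces it to the trace inequality `tr Y² - T tr Y ≥ T`. -/
theorem PosDef.exists_barrier_step {ι : Type*} {w : ι → n → 𝕜}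
    (hw : ∀ B : Matrix n n 𝕜, B.IsHermitian →
      ∃ x, RCLike.re B.trace ≤ RCLike.re (star (w x) ⬝ᵥ (B *ᵥ w x)))
    {H : Matrix n n 𝕜} (hH : H.PosDef) (htr : RCLike.re (H⁻¹).trace ≤ 1) :
    ∃ x, (H - (2⁻¹ : ℝ) • (1 : Matrix n n 𝕜) + vecMulVec (w x) (star (w x))).PosDef ∧
      RCLike.re (H - (2⁻¹ : ℝ) • (1 : Matrix n n 𝕜)
        + vecMulVec (w x) (star (w x)))⁻¹.trace ≤ 1 := by
  set R : Matrix n n 𝕜 := H - (2⁻¹ : ℝ) • (1 : Matrix n n 𝕜) with hRdef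
  have hR : R.PosDef := by
    have h1 := hH.one_le_of_trace_inv_le htr
    have h2 : ((2⁻¹ : ℝ) • (1 : Matrix n n 𝕜)).PosDef := PosDef.one.smul (by norm_num)
    have h3 : R = (H - 1) + (2⁻¹ : ℝ) • (1 : Matrix n n 𝕜) := by rw [hRdef]; module
    rw [h3]
    exact PosDef.posSemidef_add h1 h2
  have hHdet : IsUnit H.det := (Matrix.isUnit_iff_isUnit_det H).1 hH.isUnit
  have hRdet : IsUnit R.det := (Matrix.isUnit_iff_isUnit_det R).1 hR.isUnit
  set Y := R⁻¹ with hY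
  set Z := H⁻¹ with hZ
  have hYpos : Y.PosDef := hR.inv
  have hZpos : Z.PosDef := hH.inv
  have hres : Y - Z = (2⁻¹ : ℝ) • (Y * Z) := by
    have h1 : Y * (H - R) * Z = (2⁻¹ : ℝ) • (Y * Z) := by
      rw [hRdef, sub_sub_cancel, Matrix.mul_smul, mul_one, Matrix.smul_mul]
    rw [← h1, mul_sub, sub_mul, mul_assoc, hZ, mul_nonsing_inv _ hHdet, hY,
      nonsing_inv_mul _ hRdet, mul_one, one_mul]
  set T : ℝ := RCLike.re Y.trace - RCLike.re Z.trace with hT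
  set u : ℝ := RCLike.re (Y * Z).trace with hu
  set v : ℝ := RCLike.re (Y * Y * Z).trace with hv
  have hTu : T = 2⁻¹ * u := by
    rw [hT, ← map_sub, ← trace_sub, hres, trace_smul, RCLike.smul_re]
  have hu0 : 0 ≤ u := hYpos.posSemidef.re_trace_mul_nonneg hZpos.posSemidef
  have hYY : RCLike.re (Y * Y).trace - u = 2⁻¹ * v := by
    rw [hu, ← map_sub, ← trace_sub, ← mul_sub, hres, Matrix.mul_smul, trace_smul, RCLike.smul_re,
      ← mul_assoc]
  -- The trace of `(Y - u) Z (Y - u) ≥ 0`. As `tr Z ≤ 1`, it yields `u² ≤ v`.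
  have hcs : 0 ≤ v - 2 * u * u + u ^ 2 * RCLike.re Z.trace := by
    have h1 := (RCLike.nonneg_iff.1
      (hZpos.posSemidef.conjTranspose_mul_mul_same (Y - u • (1 : Matrix n n 𝕜))).trace_nonneg).1
    have h2 : (Y - u • (1 : Matrix n n 𝕜))ᴴ = Y - u • (1 : Matrix n n 𝕜) := by
      rw [conjTranspose_sub, conjTranspose_smul, hYpos.isHermitian.eq, conjTranspose_one]
      simp
    rw [h2] at h1
    have h3 : (Y - u • (1 : Matrix n n 𝕜)) * Z * (Y - u • (1 : Matrix n n 𝕜))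
        = Y * Z * Y - u • (Y * Z) - u • (Z * Y) + (u * u) • Z := by
      simp only [sub_mul, mul_sub, Matrix.smul_mul, Matrix.mul_smul, one_mul, mul_one,
        smul_smul]
      abel
    rw [h3, trace_add, trace_sub, trace_sub, trace_smul, trace_smul, trace_smul,
      trace_mul_comm Z Y, trace_mul_cycle] at h1
    simp only [map_add, map_sub, RCLike.smul_re] at h1
    rw [← hu, ← hv] at h1
    linarith
  -- Here `T = u/2`, `tr Y² = u + v/2 ≥ u + u²/2`, and `T tr Y ≤ (u/2)(u/2 + 1)`; the difference is
  -- at least `u/2 + u²/4`.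
  have hTT : T ≤ RCLike.re (Y * Y).trace - T * RCLike.re Y.trace := by
    have h1 : RCLike.re Y.trace = T + RCLike.re Z.trace := by rw [hT]; ring
    rw [h1, hTu]
    nlinarith [mul_nonneg hu0 (sub_nonneg.2 htr), mul_nonneg (sq_nonneg u) (sub_nonneg.2 htr)]
  have hYh := hYpos.isHermitian
  obtain ⟨x, hx⟩ := hw (Y * Y - T • Y) (by
    rw [IsHermitian, conjTranspose_sub, conjTranspose_mul, conjTranspose_smul, hYh.eq]
    simp)
  refine ⟨x, hR.add_posSemidef (posSemidef_vecMulVec_self_star _), ?_⟩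
  rw [hR.trace_inv_add_vecMulVec, ← hY]
  rw [trace_sub, trace_smul, sub_mulVec, smul_mulVec, dotProduct_sub, dotProduct_smul] at hx
  simp only [map_sub, RCLike.smul_re] at hx
  have hq := hYpos.posSemidef.re_dotProduct_nonneg (w x)
  have hdiv : T ≤ RCLike.re (star (w x) ⬝ᵥ ((Y * Y) *ᵥ w x)) /
      (1 + RCLike.re (star (w x) ⬝ᵥ (Y *ᵥ w x))) := by
    rw [le_div_iff₀ (by positivity)]
    linarith
  linarith

theorem exists_sum_vecMulVec_posDef [Nonempty n] {ι : Type*} {w : ι → n → 𝕜}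
    (hw : ∀ B : Matrix n n 𝕜, B.IsHermitian →
      ∃ x, RCLike.re B.trace ≤ RCLike.re (star (w x) ⬝ᵥ (B *ᵥ w x))) (m : ℕ) :
    ∃ x : Fin m → ι,
      (∑ j, vecMulVec (w (x j)) (star (w (x j)))
        + ((Fintype.card n : ℝ) - m / 2) • (1 : Matrix n n 𝕜)).PosDef ∧
      RCLike.re (∑ j, vecMulVec (w (x j)) (star (w (x j)))
        + ((Fintype.card n : ℝ) - m / 2) • (1 : Matrix n n 𝕜))⁻¹.trace ≤ 1 := by
  induction m with
  | zero =>
    have hcard : (0 : ℝ) < Fintype.card n := by exact_mod_cast Fintype.card_pos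
    -- The barrier starts at `-card n`, so that the initial trace is exactly `1`.
    refine ⟨Fin.elim0, ?_, ?_⟩
    · simpa using (PosDef.one (n := n) (R := 𝕜)).smul hcard
    · have h : ((Fintype.card n : ℝ) • (1 : Matrix n n 𝕜))⁻¹
          = ((Fintype.card n : ℝ)⁻¹) • (1 : Matrix n n 𝕜) := by
        apply inv_eq_right_inv
        rw [Matrix.smul_mul, one_mul, smul_smul, mul_inv_cancel₀ hcard.ne', one_smul]
      simp only [Finset.univ_eq_empty, Finset.sum_empty, zero_add, Nat.cast_zero, zero_div,
        sub_zero]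
      rw [h, trace_smul, trace_one, RCLike.smul_re, RCLike.natCast_re, inv_mul_cancel₀ hcard.ne']
  | succ m ih =>
    obtain ⟨x, hx, htr⟩ := ih
    obtain ⟨y, hy, hytr⟩ := hx.exists_barrier_step hw htr
    refine ⟨Fin.snoc x y, ?_⟩
    have h : ∑ j, vecMulVec (w ((Fin.snoc x y : Fin (m + 1) → ι) j))
          (star (w ((Fin.snoc x y : Fin (m + 1) → ι) j)))
          + ((Fintype.card n : ℝ) - (m + 1 : ℕ) / 2) • (1 : Matrix n n 𝕜)
        = ∑ j, vecMulVec (w (x j)) (star (w (x j)))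
          + ((Fintype.card n : ℝ) - m / 2) • (1 : Matrix n n 𝕜)
          - (2⁻¹ : ℝ) • (1 : Matrix n n 𝕜) + vecMulVec (w y) (star (w y)) := by
      rw [Fin.sum_univ_castSucc]
      simp only [Fin.snoc_castSucc, Fin.snoc_last]
      push_cast
      module
    rw [h]
    exact ⟨hy, hytr⟩

end

/-! ### The closed convex hull of the rank one matrices -/

variable {𝕜 n : Type*} [RCLike 𝕜]

theorem convex_setOf_posSemidef : Convex ℝ {A : Matrix n n 𝕜 | A.PosSemidef} :=
  fun _ hA _ hB _ _ ha hb _ => (PosSemidef.smul hA ha).add (PosSemidef.smul hB hb)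

variable {ι : Type*}

/-- The closed convex hull of the rank one matrices `u(x) u(x)*`. -/
def rankOneHull (u : ι → n → 𝕜) : Set (Matrix n n 𝕜) :=
  closedConvexHull ℝ (Set.range fun x => vecMulVec (u x) (star (u x)))

theorem vecMulVec_mem_rankOneHull (u : ι → n → 𝕜) (x : ι) :
    vecMulVec (u x) (star (u x)) ∈ rankOneHull u :=
  subset_closedConvexHull ⟨x, rfl⟩

theorem convex_rankOneHull (u : ι → n → 𝕜) : Convex ℝ (rankOneHull u) :=
  convex_closedConvexHull

theorem isClosed_rankOneHull (u : ι → n → 𝕜) : IsClosed (rankOneHull u) :=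
  isClosed_closedConvexHull

theorem continuous_vecMulVec_self_star [TopologicalSpace ι] {u : ι → n → 𝕜} (hu : Continuous u) :
    Continuous fun x => vecMulVec (u x) (star (u x)) :=
  hu.matrix_vecMulVec hu.star

variable [Fintype n]

theorem star_dotProduct_vecMulVec_mulVec (u c : n → 𝕜) :
    star c ⬝ᵥ (vecMulVec u (star u) *ᵥ c) = ((‖star u ⬝ᵥ c‖ ^ 2 : ℝ) : 𝕜) := by
  rw [vecMulVec_mulVec, op_smul_eq_smul, dotProduct_smul, star_dotProduct c u, smul_eq_mul,
    RCLike.star_def, RCLike.mul_conj]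
  push_cast; rfl

/-- The real part of the quadratic form `A ↦ c* A c`, as a functional of the matrix. -/
def reQuadForm (c : n → 𝕜) : Matrix n n 𝕜 →ₗ[ℝ] ℝ where
  toFun A := RCLike.re (star c ⬝ᵥ (A *ᵥ c))
  map_add' A B := by simp [add_mulVec, dotProduct_add]
  map_smul' r A := by simp [smul_mulVec, dotProduct_smul, RCLike.smul_re]

theorem reQuadForm_apply (c : n → 𝕜) (A : Matrix n n 𝕜) :
    reQuadForm c A = RCLike.re (star c ⬝ᵥ (A *ᵥ c)) := rfl

theorem reQuadForm_vecMulVec (u c : n → 𝕜) :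
    reQuadForm c (vecMulVec u (star u)) = ‖star u ⬝ᵥ c‖ ^ 2 := by
  rw [reQuadForm_apply, star_dotProduct_vecMulVec_mulVec, RCLike.ofReal_re]

theorem continuous_reQuadForm (c : n → 𝕜) : Continuous (reQuadForm c) := by
  change Continuous fun A : Matrix n n 𝕜 => RCLike.re (star c ⬝ᵥ (A *ᵥ c))
  fun_prop

theorem isClosed_setOf_posSemidef : IsClosed {A : Matrix n n 𝕜 | A.PosSemidef} := by
  have h : {A : Matrix n n 𝕜 | A.PosSemidef} =
      {A | Aᴴ = A} ∩ ⋂ c : n → 𝕜, {A | 0 ≤ reQuadForm c A} := by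
    ext A
    simp only [Set.mem_inter_iff, Set.mem_iInter, Set.mem_ofPred_eq]
    refine ⟨fun hA => ⟨hA.isHermitian, hA.re_dotProduct_nonneg⟩, fun hA => ?_⟩
    refine .of_dotProduct_mulVec_nonneg hA.1 fun c => RCLike.nonneg_iff.2 ⟨hA.2 c, ?_⟩
    exact IsHermitian.im_star_dotProduct_mulVec_self hA.1 c
  rw [h]
  exact (isClosed_eq (by fun_prop) continuous_id).inter
    (isClosed_iInter fun c => isClosed_le continuous_const (continuous_reQuadForm c))

theorem posSemidef_of_mem_rankOneHull {u : ι → n → 𝕜} {A : Matrix n n 𝕜}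
    (hA : A ∈ rankOneHull u) : A.PosSemidef := by
  have h : (Set.range fun x => vecMulVec (u x) (star (u x))) ⊆
      {A : Matrix n n 𝕜 | A.PosSemidef} := by
    rintro _ ⟨x, rfl⟩
    exact posSemidef_vecMulVec_self_star (u x)
  exact closedConvexHull_min h convex_setOf_posSemidef isClosed_setOf_posSemidef hA

/-- Take `M` in the hull with minimal kernel. A nonzero `c` in the kernel is detected by some `u x`,
and averaging `M` with `u(x) u(x)*` would strictly shrink the kernel. -/
theorem exists_posDef_mem_rankOneHull [Nonempty ι] {u : ι → n → 𝕜}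
    (hsep : ∀ c, (∀ x, star (u x) ⬝ᵥ c = 0) → c = 0) :
    ∃ M ∈ rankOneHull u, M.PosDef := by
  obtain ⟨x₀⟩ := ‹Nonempty ι›
  obtain ⟨_, ⟨M, hM, rfl⟩, hmin⟩ := IsArtinian.set_has_minimal
    ((fun A : Matrix n n 𝕜 => LinearMap.ker A.mulVecLin) '' rankOneHull u)
    ⟨_, _, vecMulVec_mem_rankOneHull u x₀, rfl⟩
  have hMp := posSemidef_of_mem_rankOneHull hM
  refine ⟨M, hM, .of_dotProduct_mulVec_pos hMp.isHermitian fun c hc => ?_⟩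
  refine (hMp.dotProduct_mulVec_nonneg c).lt_of_ne' fun h0 => hc (hsep c fun x => ?_)
  by_contra hx
  set S := vecMulVec (u x) (star (u x)) with hS
  have hSp : S.PosSemidef := posSemidef_vecMulVec_self_star _
  refine hmin _ ⟨(2⁻¹ : ℝ) • M + (2⁻¹ : ℝ) • S, convex_rankOneHull u hM
    (vecMulVec_mem_rankOneHull u x) (by norm_num) (by norm_num) (by norm_num), rfl⟩ ?_
  have key : ∀ y : n → 𝕜, ((2⁻¹ : ℝ) • M + (2⁻¹ : ℝ) • S) *ᵥ y = 0 →
      reQuadForm y M = 0 ∧ reQuadForm y S = 0 := by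
    intro y hy
    have h1 : reQuadForm y ((2⁻¹ : ℝ) • M + (2⁻¹ : ℝ) • S) = 0 := by
      rw [reQuadForm_apply, hy]; simp
    have h2 : 0 ≤ reQuadForm y M := hMp.re_dotProduct_nonneg y
    have h3 : 0 ≤ reQuadForm y S := hSp.re_dotProduct_nonneg y
    simp only [map_add, map_smul, smul_eq_mul] at h1
    constructor <;> linarith
  have hzero : ∀ y : n → 𝕜, reQuadForm y M = 0 → M *ᵥ y = 0 := by
    intro y hy
    rw [← hMp.dotProduct_mulVec_zero_iff]
    apply RCLike.ext
    · rw [← reQuadForm_apply, hy, map_zero]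
    · simpa using hMp.isHermitian.im_star_dotProduct_mulVec_self y
  refine lt_of_le_of_ne (fun y hy => ?_) fun heq => ?_
  · simp only [LinearMap.mem_ker, mulVecLin_apply] at hy ⊢
    exact hzero y (key y hy).1
  · have hcM : c ∈ LinearMap.ker M.mulVecLin := by
      simpa using (hMp.dotProduct_mulVec_zero_iff c).1 h0
    simp only at heq
    rw [← heq, LinearMap.mem_ker, mulVecLin_apply] at hcM
    have h := (key c hcM).2
    rw [hS, reQuadForm_vecMulVec] at h
    exact hx (by simpa using h)

variable [TopologicalSpace ι] [CompactSpace ι]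

theorem isCompact_rankOneHull {u : ι → n → 𝕜} (hu : Continuous u) :
    IsCompact (rankOneHull u) := by
  have h1 : Bornology.IsBounded (α := n → n → 𝕜)
      (Set.range fun x => vecMulVec (u x) (star (u x))) :=
    (isCompact_range (Y := n → n → 𝕜) (continuous_vecMulVec_self_star hu)).isBounded
  have h2 := (isBounded_convexHull.2 h1).closure
  rw [rankOneHull, closedConvexHull_eq_closure_convexHull]
  have : ProperSpace (n → n → 𝕜) := FiniteDimensional.proper ℝ _
  exact Metric.isCompact_of_isClosed_isBounded (α := n → n → 𝕜) isClosed_closure h2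

theorem exists_mem_rankOneHull_integral [MeasurableSpace ι] [OpensMeasurableSpace ι]
    (μ : Measure ι) [IsProbabilityMeasure μ] {u : ι → n → 𝕜} (hu : Continuous u) :
    ∃ A ∈ rankOneHull u, ∀ c, reQuadForm c A = ∫ x, ‖star (u x) ⬝ᵥ c‖ ^ 2 ∂μ := by
  let F : ι → n → n → 𝕜 := fun x => vecMulVec (u x) (star (u x))
  have hF : Continuous F := continuous_vecMulVec_self_star hu
  have hint : Integrable F μ :=
    hF.integrable_of_hasCompactSupport (HasCompactSupport.of_compactSpace _)
  have : CompleteSpace (n → n → 𝕜) := FiniteDimensional.complete ℝ _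
  refine ⟨(∫ x, F x ∂μ : n → n → 𝕜), Convex.integral_mem (E := n → n → 𝕜) (convex_rankOneHull u)
    (isClosed_rankOneHull u) (.of_forall (vecMulVec_mem_rankOneHull u)) hint, fun c => ?_⟩
  let L : (n → n → 𝕜) →L[ℝ] ℝ := ⟨reQuadForm c, continuous_reQuadForm c⟩
  exact (L.integral_comp_comm hint).symm.trans
    (integral_congr_ae (.of_forall fun x => reQuadForm_vecMulVec _ _))

/-- A linear functional on the hull is bounded by its maximum over the generators, which is attained
since `ι` is compact. This replaces averaging over a probability measure representing `G`. -/
theorem exists_re_trace_mul_le [Nonempty ι] {u : ι → n → 𝕜} (hu : Continuous u)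
    {G : Matrix n n 𝕜} (hG : G ∈ rankOneHull u) (B : Matrix n n 𝕜) :
    ∃ x, RCLike.re (B * G).trace ≤ RCLike.re (star (u x) ⬝ᵥ (B *ᵥ u x)) := by
  have hcont : Continuous fun x => RCLike.re (star (u x) ⬝ᵥ (B *ᵥ u x)) := by fun_prop
  obtain ⟨x, -, hx⟩ := isCompact_univ.exists_isMaxOn Set.univ_nonempty hcont.continuousOn
  refine ⟨x, ?_⟩
  let L : Matrix n n 𝕜 →ₗ[ℝ] ℝ :=
    { toFun A := RCLike.re (B * A).trace
      map_add' A A' := by simp [mul_add]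
      map_smul' r A := by simp [RCLike.smul_re] }
  have hL : Continuous L := by
    change Continuous fun A : Matrix n n 𝕜 => RCLike.re (B * A).trace
    fun_prop
  refine closedConvexHull_min (t := {A | L A ≤ RCLike.re (star (u x) ⬝ᵥ (B *ᵥ u x))}) ?_
    (convex_halfSpace_le L.isLinear _) (isClosed_le hL continuous_const) hG
  rintro _ ⟨y, rfl⟩
  have h : L (vecMulVec (u y) (star (u y))) = RCLike.re (star (u y) ⬝ᵥ (B *ᵥ u y)) := by
    change RCLike.re (B * vecMulVec (u y) (star (u y))).trace = _
    rw [mul_vecMulVec, trace_vecMulVec, dotProduct_comm]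
  exact h.le.trans (hx (Set.mem_univ y))

/-! ### Determinant maximization and the choice of the points -/

variable [DecidableEq n]

theorem det_add_smul_vecMulVec {M : Matrix n n 𝕜} (hM : IsUnit M.det) (s : 𝕜) (u v : n → 𝕜) :
    (M + s • vecMulVec u v).det = M.det * (1 + s * (v ⬝ᵥ (M⁻¹ *ᵥ u))) := by
  have h := det_add_mul (replicateCol Unit (s • u)) (replicateRow Unit v) hM
  rw [← vecMulVec_eq, smul_vecMulVec, Matrix.mul_assoc, ← replicateCol_mulVec,
    det_unique (n := Unit), add_apply, one_apply_eq, replicateRow_mul_replicateCol_apply,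
    mulVec_smul, dotProduct_smul, smul_eq_mul] at h
  exact h

/-- Compare the right derivatives at `s = 0`, where both sides equal `1`. -/
theorem le_of_forall_one_add_mul_le_pow {q : ℝ} {N : ℕ}
    (h : ∀ s : ℝ, 0 < s → 1 + s * q ≤ (1 + s) ^ N) : q ≤ N := by
  have hder : HasDerivAt (fun s : ℝ => (1 + s) ^ N - (1 + s * q)) (N - q) 0 := by
    have h1 : HasDerivAt (fun s : ℝ => (1 + s) ^ N) N 0 := by
      simpa using ((hasDerivAt_id' (0 : ℝ)).const_add 1).fun_pow N
    have h2 : HasDerivAt (fun s : ℝ => 1 + s * q) q 0 := by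
      simpa using ((hasDerivAt_id (0 : ℝ)).mul_const q).const_add 1
    exact h1.sub h2
  have hlim := (hasDerivAt_iff_tendsto_slope.1 hder).mono_left
    (nhdsWithin_mono _ (fun s (hs : s ∈ Set.Ioi (0 : ℝ)) => ne_of_gt hs))
  have : 0 ≤ (N : ℝ) - q := by
    refine ge_of_tendsto hlim ?_
    filter_upwards [self_mem_nhdsWithin] with s hs
    have hs' : 0 < s := hs
    rw [slope_def_field]
    have := h s hs'
    apply div_nonneg <;> simp <;> linarith
  linarith

/-- **Kiefer–Wolfowitz**: a matrix in the hull that maximizes the determinant. -/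
theorem exists_kiefer_wolfowitz [Nonempty ι] {u : ι → n → 𝕜} (hu : Continuous u)
    (hsep : ∀ c, (∀ x, star (u x) ⬝ᵥ c = 0) → c = 0) :
    ∃ M ∈ rankOneHull u, M.PosDef ∧
      ∀ x c, ‖star (u x) ⬝ᵥ c‖ ^ 2 ≤ Fintype.card n * reQuadForm c M := by
  obtain ⟨M₀, hM₀, hM₀p⟩ := exists_posDef_mem_rankOneHull hsep
  obtain ⟨M, hM, hmax⟩ := (isCompact_rankOneHull hu).exists_isMaxOn ⟨M₀, hM₀⟩
    (f := fun A => RCLike.re A.det) (by fun_prop)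
  have hdet : 0 < RCLike.re M.det :=
    (RCLike.pos_iff.1 hM₀p.det_pos).1.trans_le (hmax hM₀)
  have hMp : M.PosDef := by
    rw [(posSemidef_of_mem_rankOneHull hM).posDef_iff_det_ne_zero]
    intro h
    simp [h] at hdet
  have hMu : IsUnit M.det := (Matrix.isUnit_iff_isUnit_det M).1 hMp.isUnit
  have hMdet : M.det = ((RCLike.re M.det : ℝ) : 𝕜) := by
    apply RCLike.ext
    · simp
    · simp [(RCLike.pos_iff.1 hMp.det_pos).2]
  refine ⟨M, hM, hMp, fun x c => (hMp.norm_sq_star_dotProduct_le (u x) c).trans ?_⟩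
  refine mul_le_mul_of_nonneg_right ?_ (hMp.posSemidef.re_dotProduct_nonneg c)
  -- It remains to show `u* M⁻¹ u ≤ N`. Moving from `M` towards `u u*` inside the hull cannot
  -- increase the determinant; by the matrix determinant lemma this says `1 + s q ≤ (1 + s)^N` with
  -- `q = u* M⁻¹ u`.
  refine le_of_forall_one_add_mul_le_pow fun s hs => ?_
  have hmem : (1 + s)⁻¹ • (M + s • vecMulVec (u x) (star (u x))) ∈ rankOneHull u := by
    rw [smul_add, smul_smul]
    refine convex_rankOneHull u hM (vecMulVec_mem_rankOneHull u x) (by positivity) (by positivity)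
      (by field_simp)
  have hle : RCLike.re ((1 + s)⁻¹ • (M + s • vecMulVec (u x) (star (u x)))).det
    ≤ RCLike.re M.det := hmax hmem
  have hsc : s • vecMulVec (u x) (star (u x)) = (s : 𝕜) • vecMulVec (u x) (star (u x)) :=
    RCLike.real_smul_eq_coe_smul _ _
  rw [RCLike.real_smul_eq_coe_smul (K := 𝕜), det_smul, hsc, det_add_smul_vecMulVec hMu, hMdet,
    ← RCLike.ofReal_pow, RCLike.re_ofReal_mul, RCLike.re_ofReal_mul, map_add, RCLike.re_ofReal_mul,
    RCLike.one_re, RCLike.ofReal_re, inv_pow] at hle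
  have hpow : 0 < (1 + s) ^ Fintype.card n := by positivity
  rw [inv_mul_le_iff₀ hpow, mul_comm] at hle
  exact le_of_mul_le_mul_right hle hdet

theorem exists_points_norm_sq_le [Nonempty n] [Nonempty ι] [MeasurableSpace ι]
    [OpensMeasurableSpace ι]
    (μ : Measure ι) [IsProbabilityMeasure μ] {u : ι → n → 𝕜} (hu : Continuous u)
    (hsep : ∀ c, (∀ x, star (u x) ⬝ᵥ c = 0) → c = 0) :
    ∃ x : Fin (4 * Fintype.card n) → ι, ∀ c,
      (∀ y, ‖star (u y) ⬝ᵥ c‖ ^ 2 ≤ 2 * ∑ j, ‖star (u (x j)) ⬝ᵥ c‖ ^ 2) ∧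
      Fintype.card n * ∫ y, ‖star (u y) ⬝ᵥ c‖ ^ 2 ∂μ
        ≤ 2 * ∑ j, ‖star (u (x j)) ⬝ᵥ c‖ ^ 2 := by
  obtain ⟨M, hM, hMp, hMle⟩ := exists_kiefer_wolfowitz hu hsep
  obtain ⟨A, hA, hAint⟩ := exists_mem_rankOneHull_integral μ hu
  have hAp := posSemidef_of_mem_rankOneHull hA
  set G : Matrix n n 𝕜 := (2⁻¹ : ℝ) • M + (2⁻¹ : ℝ) • A with hGdef
  have hG : G ∈ rankOneHull u :=
    convex_rankOneHull u hM hA (by norm_num) (by norm_num) (by norm_num)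
  have hGp : G.PosDef :=
    (hMp.smul (by norm_num : (0 : ℝ) < 2⁻¹)).add_posSemidef
      (hAp.smul (by norm_num : (0 : ℝ) ≤ 2⁻¹))
  obtain ⟨P, hPu, hP⟩ := hGp.exists_mul_mul_conjTranspose_eq_one
  have hPdet := (Matrix.isUnit_iff_isUnit_det P).1 hPu
  have hw : ∀ B : Matrix n n 𝕜, B.IsHermitian →
      ∃ x, RCLike.re B.trace ≤ RCLike.re (star (P *ᵥ u x) ⬝ᵥ (B *ᵥ (P *ᵥ u x))) := by
    intro B _
    obtain ⟨x, hx⟩ := exists_re_trace_mul_le hu hG (Pᴴ * B * P)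
    refine ⟨x, ?_⟩
    have h1 : (Pᴴ * B * P * G).trace = B.trace := by
      rw [mul_assoc, mul_assoc, trace_mul_comm, mul_assoc, hP, mul_one]
    have h2 : star (P *ᵥ u x) ⬝ᵥ (B *ᵥ (P *ᵥ u x))
        = star (u x) ⬝ᵥ ((Pᴴ * B * P) *ᵥ u x) := by
      rw [star_mulVec, ← dotProduct_mulVec, mulVec_mulVec, mulVec_mulVec, mul_assoc]
    rw [h2, ← h1]
    exact hx
  -- With `m = 4 N` the shift `N - m / 2` equals `-N`, so the sum of the `w w*` dominates `N` times
  -- the identity; undoing `P` gives `hmain`.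
  obtain ⟨x, hx, -⟩ := exists_sum_vecMulVec_posDef hw (4 * Fintype.card n)
  refine ⟨x, fun c => ?_⟩
  have hmain : Fintype.card n * reQuadForm c G ≤ ∑ j, ‖star (u (x j)) ⬝ᵥ c‖ ^ 2 := by
    have h0 := hx.posSemidef.re_dotProduct_nonneg ((Pᴴ)⁻¹ *ᵥ c)
    have hPi : (P⁻¹)ᴴ = (Pᴴ)⁻¹ := conjTranspose_nonsing_inv P
    have hone : reQuadForm ((Pᴴ)⁻¹ *ᵥ c) 1 = reQuadForm c G := by
      have hGeq : G = P⁻¹ * (Pᴴ)⁻¹ := by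
        have h1 : P⁻¹ * (P * G * Pᴴ) * (Pᴴ)⁻¹ = P⁻¹ * (Pᴴ)⁻¹ := by rw [hP, mul_one]
        rw [← h1, mul_assoc P, nonsing_inv_mul_cancel_left _ _ hPdet,
          mul_nonsing_inv_cancel_right _ _ (by rw [det_conjTranspose]; exact hPdet.star)]
      rw [reQuadForm_apply, reQuadForm_apply, one_mulVec, star_mulVec, ← hPi,
        conjTranspose_conjTranspose, ← dotProduct_mulVec, mulVec_mulVec, hPi, ← hGeq]
    have hj : ∀ y, star (P *ᵥ u y) ⬝ᵥ ((Pᴴ)⁻¹ *ᵥ c) = star (u y) ⬝ᵥ c := by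
      intro y
      rw [star_mulVec, ← dotProduct_mulVec, mulVec_mulVec,
        mul_nonsing_inv _ (by rw [det_conjTranspose]; exact hPdet.star), one_mulVec]
    rw [← reQuadForm_apply, map_add, map_smul, map_sum, hone] at h0
    simp only [reQuadForm_vecMulVec, hj, smul_eq_mul] at h0
    push_cast at h0
    linarith
  have hGq : reQuadForm c G = 2⁻¹ * reQuadForm c M + 2⁻¹ * reQuadForm c A := by
    rw [hGdef, map_add, map_smul, map_smul]; rfl
  have hM0 : 0 ≤ reQuadForm c M := hMp.posSemidef.re_dotProduct_nonneg c
  have hA0 : 0 ≤ reQuadForm c A := hAp.re_dotProduct_nonneg c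
  have hN : (0 : ℝ) ≤ Fintype.card n := Nat.cast_nonneg _
  rw [hGq] at hmain
  refine ⟨fun y => (hMle y c).trans ?_, ?_⟩
  · nlinarith [mul_nonneg hN hA0]
  · rw [← hAint]
    nlinarith [mul_nonneg hN hM0]

end Matrix

/-! ### Growth of `Φ` and the Luxemburg functional -/

theorem AIncWith.le_mul_div_rpow {p : ℝ} {a : ℝ≥0} {Φ : ℝ≥0 → ℝ≥0} (h : AIncWith p a Φ)
    (hΦ : Φ 0 = 0) {t T : ℝ≥0} (htT : t ≤ T) (hT : 0 < T) :
    (Φ t : ℝ) ≤ a * Φ T * ((t : ℝ) / T) ^ p := by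
  rcases eq_or_ne t 0 with rfl | ht
  · rw [hΦ, NNReal.coe_zero]; positivity
  have ht0 : 0 < t := pos_iff_ne_zero.2 ht
  have h1 : Φ t * t ^ (-p) ≤ a * (Φ T * T ^ (-p)) := by
    rcases htT.eq_or_lt with rfl | hlt
    · exact le_mul_of_one_le_left zero_le h.1
    · exact h.2 t T ht0 hlt
  have h2 : (Φ t : ℝ) * (t : ℝ) ^ (-p) ≤ a * (Φ T * (T : ℝ) ^ (-p)) := by exact_mod_cast h1
  have ht' : (0 : ℝ) < t := ht0
  have hT' : (0 : ℝ) < T := hT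
  rw [Real.rpow_neg ht'.le, Real.rpow_neg hT'.le] at h2
  have htp : (0 : ℝ) < (t : ℝ) ^ p := Real.rpow_pos_of_pos ht' p
  rw [← div_eq_mul_inv, div_le_iff₀ htp] at h2
  rw [Real.div_rpow ht'.le hT'.le]
  calc (Φ t : ℝ) ≤ _ := h2
    _ = _ := by ring

theorem AIncWith.le_mul_div_sq {p : ℝ} {a : ℝ≥0} {Φ : ℝ≥0 → ℝ≥0} (h : AIncWith p a Φ)
    (hp : 2 ≤ p) (hΦ : Φ 0 = 0) {N : ℕ} (hN : 1 ≤ N) {Λ s : ℝ≥0} (hΛ : 1 ≤ Λ)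
    (hs : s ≤ NNReal.sqrt N) :
    (Φ (s / Λ) : ℝ) ≤ a * (Φ (NNReal.sqrt N) / N) / (Λ : ℝ) ^ p * (s : ℝ) ^ 2 := by
  have hN0 : (0 : ℝ≥0) < N := by exact_mod_cast hN
  have hN0' : (0 : ℝ) < N := by exact_mod_cast hN
  have hT : 0 < NNReal.sqrt N := NNReal.sqrt_pos.2 hN0
  have hΛ' : (1 : ℝ) ≤ Λ := hΛ
  have hT' : (0 : ℝ) < (NNReal.sqrt N : ℝ≥0) := hT
  have hsT : (s : ℝ) / (NNReal.sqrt N : ℝ≥0) ≤ 1 := (div_le_one hT').2 hs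
  have hle : s / Λ ≤ NNReal.sqrt N := (div_le_self zero_le hΛ).trans hs
  refine (h.le_mul_div_rpow hΦ hle hT).trans ?_
  have h1 : ((s / Λ : ℝ≥0) : ℝ) / (NNReal.sqrt N : ℝ≥0) = (s / (NNReal.sqrt N : ℝ≥0)) / Λ := by
    push_cast; ring
  rw [h1, Real.div_rpow (by positivity) (by positivity)]
  -- The base is at most `1`, so the exponent may be lowered from `p` to `2`.
  have h2 : ((s : ℝ) / (NNReal.sqrt N : ℝ≥0)) ^ p ≤ (s : ℝ) ^ 2 / N := by
    rcases eq_or_ne s 0 with rfl | hs0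
    · simp [Real.zero_rpow (by linarith : p ≠ 0)]
    have hs0' : (0 : ℝ) < s := NNReal.coe_pos.2 (pos_iff_ne_zero.2 hs0)
    refine (Real.rpow_le_rpow_of_exponent_ge (by positivity) hsT hp).trans_eq ?_
    rw [Real.rpow_two, div_pow, Real.coe_sqrt, Real.sq_sqrt (by positivity), NNReal.coe_natCast]
  calc (a : ℝ) * Φ (NNReal.sqrt N) * (((s : ℝ) / (NNReal.sqrt N : ℝ≥0)) ^ p / (Λ : ℝ) ^ p)
      ≤ a * Φ (NNReal.sqrt N) * ((s : ℝ) ^ 2 / N / (Λ : ℝ) ^ p) := by gcongr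
    _ = _ := by ring

theorem luxemburgNorm_le_of_modular_le {α E : Type*} [MeasurableSpace α] [NormedAddCommGroup E]
    [NormedSpace ℝ E] {Φ : ℝ≥0 → ℝ≥0} {μ : Measure α} {f : α → E} {r : ℝ≥0} (hr : 0 < r)
    (h : orliczModular Φ μ (fun x => (r : ℝ)⁻¹ • f x) ≤ 1) : luxemburgNorm Φ μ f ≤ r :=
  (iInf_le _ r).trans ((iInf_le _ hr).trans (iInf_le _ h))

theorem luxemburgNorm_zero {α E : Type*} [MeasurableSpace α] [NormedAddCommGroup E]
    [NormedSpace ℝ E] {Φ : ℝ≥0 → ℝ≥0} (hΦ : Φ 0 = 0) (μ : Measure α) {f : α → E}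
    (hf : ∀ x, f x = 0) : luxemburgNorm Φ μ f = 0 := by
  refine le_antisymm (ENNReal.le_of_forall_pos_le_add fun ε hε _ => ?_) zero_le
  rw [zero_add]
  exact luxemburgNorm_le_of_modular_le hε (by simp [orliczModular, hf, hΦ])

/-- The dilation constant by which the Luxemburg functional is bounded in terms of the uniform norm
and of the `L²`-norm. -/
noncomputable def luxemburgConst (p : ℝ) (a : ℝ≥0) (Φ : ℝ≥0 → ℝ≥0) (N : ℕ) : ℝ :=
  (a : ℝ) ^ (2 / p) * (1 + ((Φ 1 : ℝ≥0) : ℝ)⁻¹) ^ (1 / p) *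
    (((Φ (NNReal.sqrt N) : ℝ≥0) : ℝ) / N) ^ (1 / p)

theorem luxemburgConst_nonneg (p : ℝ) (a : ℝ≥0) (Φ : ℝ≥0 → ℝ≥0) (N : ℕ) :
    0 ≤ luxemburgConst p a Φ N := by
  unfold luxemburgConst; positivity

theorem luxemburgConst_rpow {p : ℝ} (hp : 2 ≤ p) (a : ℝ≥0) (Φ : ℝ≥0 → ℝ≥0) (N : ℕ) :
    luxemburgConst p a Φ N ^ p =
      (a : ℝ) ^ 2 * (1 + (Φ 1 : ℝ)⁻¹) * ((Φ (NNReal.sqrt N) : ℝ) / N) := by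
  have hp0 : p ≠ 0 := by linarith
  rw [luxemburgConst, Real.mul_rpow (by positivity) (by positivity),
    Real.mul_rpow (by positivity) (by positivity), ← Real.rpow_mul (by positivity),
    ← Real.rpow_mul (by positivity), ← Real.rpow_mul (by positivity), div_mul_cancel₀ _ hp0,
    div_mul_cancel₀ _ hp0, Real.rpow_one, Real.rpow_one, Real.rpow_two]

theorem AIncWith.map_one_le {p : ℝ} {a : ℝ≥0} {Φ : ℝ≥0 → ℝ≥0} (h : AIncWith p a Φ)
    (hp : 2 ≤ p) (hΦ : Φ 0 = 0) {N : ℕ} (hN : 1 ≤ N) :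
    (Φ 1 : ℝ) ≤ a * (Φ (NNReal.sqrt N) / N) := by
  have hs : (1 : ℝ≥0) ≤ NNReal.sqrt N := by
    rw [NNReal.le_sqrt_iff_sq_le, one_pow]; exact_mod_cast hN
  simpa using h.le_mul_div_sq hp hΦ hN le_rfl hs

/-- In the `p`-th power, one factor `a` absorbs the loss in `Φ(1) ≤ a Φ(√N) / N`, and `(1 + Φ(1)⁻¹)
Φ(1) ≥ 1`. Thus dividing by the constant keeps arguments below `√N`. -/
theorem AIncWith.one_le_luxemburgConst {p : ℝ} {a : ℝ≥0} {Φ : ℝ≥0 → ℝ≥0} (h : AIncWith p a Φ)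
    (hp : 2 ≤ p) (hΦ : Φ 0 = 0) (hΦ1 : 0 < Φ 1) {N : ℕ} (hN : 1 ≤ N) :
    1 ≤ luxemburgConst p a Φ N := by
  have h1 := h.map_one_le hp hΦ hN
  have ha : (1 : ℝ) ≤ a := h.1
  have hΦ1' : (0 : ℝ) < Φ 1 := hΦ1
  have h2 : 1 ≤ luxemburgConst p a Φ N ^ p := by
    rw [luxemburgConst_rpow hp]
    calc (1 : ℝ) ≤ a * ((1 + (Φ 1 : ℝ)⁻¹) * Φ 1) := by
          rw [add_mul, inv_mul_cancel₀ hΦ1'.ne']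
          nlinarith
      _ ≤ a * ((1 + (Φ 1 : ℝ)⁻¹) * (a * (Φ (NNReal.sqrt N) / N))) := by gcongr
      _ = _ := by ring
  by_contra! hlt
  exact (Real.rpow_lt_one (luxemburgConst_nonneg p a Φ N) hlt (by linarith)).not_ge h2

theorem AIncWith.map_div_luxemburgConst_le {p : ℝ} {a : ℝ≥0} {Φ : ℝ≥0 → ℝ≥0}
    (h : AIncWith p a Φ) (hp : 2 ≤ p) (hΦ : Φ 0 = 0) (hΦ1 : 0 < Φ 1) {N : ℕ} (hN : 1 ≤ N)
    {s : ℝ≥0} (hs : s ≤ NNReal.sqrt N) :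
    Φ (s / (luxemburgConst p a Φ N).toNNReal) ≤ s ^ 2 := by
  have hΛ := h.one_le_luxemburgConst hp hΦ hΦ1 hN
  have h0 := h.le_mul_div_sq hp hΦ hN (Real.one_le_toNNReal.2 hΛ) hs
  rw [Real.coe_toNNReal _ (luxemburgConst_nonneg p a Φ N), luxemburgConst_rpow hp] at h0
  have ha : (1 : ℝ) ≤ a := h.1
  have hΦ1' : (0 : ℝ) < Φ 1 := hΦ1
  have h1 := h.map_one_le hp hΦ hN
  have h2 : (0 : ℝ) < a * (Φ (NNReal.sqrt N) / N) := hΦ1'.trans_le h1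
  have h3 : (1 : ℝ) ≤ a * (1 + (Φ 1 : ℝ)⁻¹) :=
    one_le_mul_of_one_le_of_one_le ha (by simp)
  have h4 : (a : ℝ) * (Φ (NNReal.sqrt N) / N) /
      ((a : ℝ) ^ 2 * (1 + (Φ 1 : ℝ)⁻¹) * ((Φ (NNReal.sqrt N) : ℝ) / N)) ≤ 1 := by
    refine div_le_one_of_le₀ ?_ (by positivity)
    calc (a : ℝ) * (Φ (NNReal.sqrt N) / N)
        ≤ a * (1 + (Φ 1 : ℝ)⁻¹) * (a * (Φ (NNReal.sqrt N) / N)) :=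
          le_mul_of_one_le_left h2.le h3
      _ = _ := by ring
  have h5 : (Φ (s / (luxemburgConst p a Φ N).toNNReal) : ℝ) ≤ (s : ℝ) ^ 2 :=
    h0.trans (mul_le_of_le_one_left (by positivity) h4)
  exact_mod_cast h5

/-- A function bounded by `K √N` with `L²`-norm at most `K` has Luxemburg functional at most
`luxemburgConst p a Φ N * K`. -/
theorem AIncWith.luxemburgNorm_le {α E : Type*} [MeasurableSpace α] [NormedAddCommGroup E]
    [NormedSpace ℝ E] {μ : Measure α} {f : α → E} {p : ℝ} {a : ℝ≥0} {Φ : ℝ≥0 → ℝ≥0}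
    (h : AIncWith p a Φ) (hp : 2 ≤ p) (hΦ : Φ 0 = 0) (hΦ1 : 0 < Φ 1) {N : ℕ} (hN : 1 ≤ N)
    {K : ℝ≥0} (hsup : ∀ x, ‖f x‖₊ ≤ K * NNReal.sqrt N)
    (hL2 : ∫⁻ x, (‖f x‖₊ : ℝ≥0∞) ^ 2 ∂μ ≤ (K : ℝ≥0∞) ^ 2) :
    luxemburgNorm Φ μ f ≤ ENNReal.ofReal (luxemburgConst p a Φ N * K) := by
  -- The radius `Λ K` must be positive, so `K = 0`, where `f` vanishes, is separate.
  rcases eq_or_ne K 0 with rfl | hK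
  · rw [luxemburgNorm_zero hΦ μ fun x => by simpa using hsup x]
    exact zero_le
  set Λ := (luxemburgConst p a Φ N).toNNReal with hΛdef
  have hΛ : 1 ≤ Λ := Real.one_le_toNNReal.2 (h.one_le_luxemburgConst hp hΦ hΦ1 hN)
  have hr : 0 < Λ * K := mul_pos (zero_lt_one.trans_le hΛ) (pos_iff_ne_zero.2 hK)
  have heq : ENNReal.ofReal (luxemburgConst p a Φ N * K) = ((Λ * K : ℝ≥0) : ℝ≥0∞) := by
    rw [ENNReal.ofReal, Real.toNNReal_mul (luxemburgConst_nonneg p a Φ N), Real.toNNReal_coe]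
  rw [heq]
  refine luxemburgNorm_le_of_modular_le hr ?_
  have hpt : ∀ x, (Φ ‖((Λ * K : ℝ≥0) : ℝ)⁻¹ • f x‖₊ : ℝ≥0∞)
      ≤ ((K : ℝ≥0∞) ^ 2)⁻¹ * (‖f x‖₊ : ℝ≥0∞) ^ 2 := by
    intro x
    have h1 : ‖((Λ * K : ℝ≥0) : ℝ)⁻¹ • f x‖₊ = ‖f x‖₊ / K / Λ := by
      rw [nnnorm_smul, nnnorm_inv, NNReal.nnnorm_eq]
      field_simp
    have hs : ‖f x‖₊ / K ≤ NNReal.sqrt N := by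
      rw [div_le_iff₀ (pos_iff_ne_zero.2 hK), mul_comm]; exact hsup x
    have h2 := h.map_div_luxemburgConst_le hp hΦ hΦ1 hN hs
    rw [h1]
    have h3 : ((K : ℝ≥0∞) ^ 2)⁻¹ * (‖f x‖₊ : ℝ≥0∞) ^ 2 = (((‖f x‖₊ / K) ^ 2 : ℝ≥0) : ℝ≥0∞) := by
      rw [div_pow, ENNReal.coe_div (pow_ne_zero 2 hK), ENNReal.coe_pow, ENNReal.coe_pow,
        ENNReal.div_eq_inv_mul]
    rw [h3]
    exact_mod_cast h2
  have hK2 : (K : ℝ≥0∞) ^ 2 ≠ 0 := pow_ne_zero 2 (by exact_mod_cast hK)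
  have hK2' : (K : ℝ≥0∞) ^ 2 ≠ ∞ := ENNReal.pow_ne_top ENNReal.coe_ne_top
  calc orliczModular Φ μ (fun x => ((Λ * K : ℝ≥0) : ℝ)⁻¹ • f x)
      ≤ ∫⁻ x, ((K : ℝ≥0∞) ^ 2)⁻¹ * (‖f x‖₊ : ℝ≥0∞) ^ 2 ∂μ := lintegral_mono hpt
    _ = ((K : ℝ≥0∞) ^ 2)⁻¹ * ∫⁻ x, (‖f x‖₊ : ℝ≥0∞) ^ 2 ∂μ :=
        lintegral_const_mul' _ _ (ENNReal.inv_ne_top.2 hK2)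
    _ ≤ ((K : ℝ≥0∞) ^ 2)⁻¹ * (K : ℝ≥0∞) ^ 2 := by gcongr
    _ = 1 := ENNReal.inv_mul_cancel hK2 hK2'

/-! ### From matrices to function spaces, and the theorem -/

/-- Every `N`-dimensional space of continuous functions admits `4 N` points whose discrete
`L²`-norm dominates both the uniform norm, up to `√N`, and the `L²(μ)`-norm. -/
theorem exists_points_norm_le_discreteL2Norm {𝕜 Ω : Type*} [RCLike 𝕜] [TopologicalSpace Ω]
    [CompactSpace Ω] [MeasurableSpace Ω] [OpensMeasurableSpace Ω]
    (μ : Measure Ω) [IsProbabilityMeasure μ] {N : ℕ} (hN : 1 ≤ N)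
    (X : Submodule 𝕜 C(Ω, 𝕜)) (hX : Module.finrank 𝕜 X = N) :
    ∃ x : Fin (4 * N) → Ω, ∀ f ∈ X,
      (∀ y, ‖f y‖ ^ 2 ≤ 9 * N * discreteL2Norm x f ^ 2) ∧
      ∫ y, ‖f y‖ ^ 2 ∂μ ≤ 9 * discreteL2Norm x f ^ 2 := by
  have : Nonempty Ω := nonempty_of_isProbabilityMeasure μ
  have : Nonempty (Fin N) := ⟨⟨0, hN⟩⟩
  have : Module.Finite 𝕜 X := Module.finite_of_finrank_pos (by omega)
  let b : Module.Basis (Fin N) 𝕜 X := Module.finBasisOfFinrankEq 𝕜 X hX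
  let u : Ω → Fin N → 𝕜 := fun y i => star ((b i : C(Ω, 𝕜)) y)
  have hu : Continuous u := continuous_pi fun i => (b i : C(Ω, 𝕜)).continuous.star
  have heval : ∀ (c : Fin N → 𝕜) (y : Ω),
      star (u y) ⬝ᵥ c = ((∑ i, c i • b i : X) : C(Ω, 𝕜)) y := by
    intro c y
    simp only [dotProduct, u, Pi.star_apply, star_star]
    rw [Submodule.coe_sum, ContinuousMap.sum_apply]
    exact Finset.sum_congr rfl fun i _ => by simp [mul_comm]
  have hsep : ∀ c, (∀ y, star (u y) ⬝ᵥ c = 0) → c = 0 := by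
    intro c hc
    have h0 : ∑ i, c i • b i = 0 := by
      apply Subtype.ext
      ext y
      rw [← heval, hc y]; rfl
    exact funext (Fintype.linearIndependent_iff.1 b.linearIndependent c h0)
  have hex := Matrix.exists_points_norm_sq_le μ hu hsep
  rw [Fintype.card_fin] at hex
  obtain ⟨x, hx⟩ := hex
  refine ⟨x, fun f hf => ?_⟩
  have hf' : ∀ y, star (u y) ⬝ᵥ (b.repr ⟨f, hf⟩ : Fin N → 𝕜) = f y := by
    intro y
    rw [heval, b.sum_repr]
  obtain ⟨h1, h2⟩ := hx (b.repr ⟨f, hf⟩)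
  simp only [hf'] at h1 h2
  have hN0 : (0 : ℝ) < N := by exact_mod_cast hN
  have hS : 0 ≤ ∑ j, ‖f (x j)‖ ^ 2 := by positivity
  -- The matrix bounds thus carry the factor `2 * 4 = 8`, rounded up to the square `9`.
  have hD : 4 * N * discreteL2Norm x f ^ 2 = ∑ j, ‖f (x j)‖ ^ 2 := by
    rw [discreteL2Norm, Real.sq_sqrt (by positivity)]
    push_cast
    field_simp
  have hD0 : 0 ≤ discreteL2Norm x f ^ 2 := sq_nonneg _
  constructor
  · intro y
    nlinarith [h1 y, mul_nonneg hN0.le hD0]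
  · refine le_of_mul_le_mul_left ?_ hN0
    nlinarith [mul_nonneg hN0.le hD0]

theorem theorem5p2 :
    ∃ c₁ : ℝ, 0 < c₁ ∧ ∃ C : ℝ, 1 ≤ C ∧
      ∀ (p : ℝ) (_ : 2 ≤ p) (Φ : ℝ≥0 → ℝ≥0) (_ : IsPhiFunction Φ) (_ : 0 < Φ 1)
        (a : ℝ≥0) (_ : AIncWith p a Φ)
        (𝕜 : Type) [RCLike 𝕜]
        (d : ℕ) (Ω : Set (EuclideanSpace ℝ (Fin d))) (_ : IsCompact Ω)
        (μ : Measure Ω) [IsProbabilityMeasure μ]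
        (N : ℕ) (_ : 1 ≤ N)
        (X : Submodule 𝕜 C(Ω, 𝕜)) (_ : Module.finrank 𝕜 X = N),
        ∃ (m : ℕ) (x : Fin m → Ω), 1 ≤ m ∧ (m : ℝ) ≤ c₁ * N ∧
          ∀ f ∈ X,
            luxemburgNorm Φ μ f ≤
              ENNReal.ofReal
                ((C * (a : ℝ) ^ (2 / p) * (1 + ((Φ 1 : ℝ≥0) : ℝ)⁻¹) ^ (1 / p)) *
                  (((Φ (NNReal.sqrt N) : ℝ≥0) : ℝ) / N) ^ (1 / p) *
                  discreteL2Norm x f) := by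
  refine ⟨4, by norm_num, 3, by norm_num, ?_⟩
  intro p hp Φ hΦ hΦ1 a ha 𝕜 _ d Ω hΩ μ _ N hN X hX
  have : CompactSpace Ω := isCompact_iff_compactSpace.1 hΩ
  obtain ⟨x, hx⟩ := exists_points_norm_le_discreteL2Norm μ hN X hX
  refine ⟨4 * N, x, by omega, by push_cast; rfl, fun f hf => ?_⟩
  obtain ⟨h1, h2⟩ := hx f hf
  have hD : 0 ≤ discreteL2Norm x f := Real.sqrt_nonneg _
  -- The square root of the factor `9`; it is also the numerical constant `C`.
  set K : ℝ≥0 := ⟨3 * discreteL2Norm x f, by positivity⟩ with hK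
  have hKc : (K : ℝ) = 3 * discreteL2Norm x f := rfl
  have hconst : (3 * (a : ℝ) ^ (2 / p) * (1 + ((Φ 1 : ℝ≥0) : ℝ)⁻¹) ^ (1 / p)) *
      (((Φ (NNReal.sqrt N) : ℝ≥0) : ℝ) / N) ^ (1 / p) * discreteL2Norm x f
      = luxemburgConst p a Φ N * K := by
    rw [luxemburgConst, hKc]; ring
  rw [hconst]
  refine ha.luxemburgNorm_le hp hΦ.map_zero hΦ1 hN (fun y => ?_) ?_
  · rw [← NNReal.coe_le_coe, coe_nnnorm, NNReal.coe_mul, Real.coe_sqrt, NNReal.coe_natCast]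
    refine abs_le_of_sq_le_sq' ?_ (by positivity) |>.2
    rw [mul_pow, Real.sq_sqrt (by positivity), hKc]
    linarith [h1 y]
  · have hint : Integrable (fun y => ‖f y‖ ^ 2) μ :=
      (f.continuous.norm.pow 2).integrable_of_hasCompactSupport
        (HasCompactSupport.of_compactSpace _)
    have h3 : ∫⁻ y, (‖f y‖₊ : ℝ≥0∞) ^ 2 ∂μ = ENNReal.ofReal (∫ y, ‖f y‖ ^ 2 ∂μ) := by
      rw [ofReal_integral_eq_lintegral_ofReal hint (.of_forall fun y => by positivity)]
      refine lintegral_congr fun y => ?_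
      rw [ENNReal.ofReal_pow (norm_nonneg _), ofReal_norm, enorm_eq_nnnorm]
    rw [h3, ← ENNReal.ofReal_coe_nnreal, ← ENNReal.ofReal_pow K.coe_nonneg]
    refine ENNReal.ofReal_le_ofReal ?_
    rw [hKc]
    linarith
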